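/- Let $A$ be a finite alphabet. A \emph{tree} over $A$ is a partial function $t:\{0,1\}^*\to A$ with prefix-closed domain; $T_A$ is the set of all trees over $A$. A \emph{prefix} $p$ over $A$ is a finite tree over $A\cup\{\star\}$ ($\star\notin A$) in which $\star$ labels only leaves, called ports; a tree $t\in T_A$ \emph{extends} $p$ ($p$ is a prefix of $t$) if $t$ is obtained from $p$ by inserting a tree over $A$ into every port, and $p[T_A]$ is the set of all $t\in T_A$ extending $p$. Equip $T_A$ with the topology whose basic open sets are the sets $p[T_A]$, $p$ a prefix. For $L\subseteq T_A$ put $[p]^{-1}L=\{t\in L: t \text{ extends } p\}$ and $L^\complement=T_A\setminus L$. For $L,M\subseteq T_A$ write $L\le_W M$ if $L=f^{-1}(M)$ for some continuous $f:T_A\to T_A$, and $L<_W M$ if $L\le_W M$ and $M\not\le_W L$; $L$ is \emph{self dual} if $L\le_W L^\complement$ and $L^\complement\le_W L$. The \emph{Wadge degree} $d_W$ is defined by recursion along $<_W$ over the non self dual sets: $d_W(\emptyset)=d_W(T_A)=1$; for any other non self dual $L$, $d_W(L)=\sup\{d_W(M)+1\}$, and for self dual $L$, $d_W(L)=\sup\{d_W(M)\}$,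 the suprema being over the non self dual $M<_W L$. If the relation $<_W$ between non self dual sets is not well-founded below $L$ (which cannot happen for Borel $L$), put $d_W(L)=\infty$, larger than every ordinal. The \emph{infinite cutting game} $\mathcal H^p_\infty(L,L^\complement)$ is played by Alternator and Constrainer in rounds $1,2,\dots$. In round $i$ Alternator first chooses a tree $t_i$, with $t_i\in L$ if $i$ is odd and $t_i\in L^\complement$ if $i$ is even, such that $t_i$ extends $p$ if $i=1$, and extends the prefix chosen by Constrainer in round $i-1$ if $i>1$; then Constrainer chooses a prefix of $t_i$. Alternator wins iff she can make infinitely many moves. Then for every language $L\subseteq T_A$ and every prefix $p$ over $A$: $d_W([p]^{-1}L)\ge\omega_1$ if and only if Alternator has a winning strategy in $\mathcal H^p_\infty(L,L^\complement)$. -/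

import Mathlib

namespace TreeLang

/-- A tree over `A`: a partial function `{0,1}* ⇀ A` whose domain is closed under prefixes.
A node is a word `v : List Bool`, its left child is `v ++ [false]` and its right child is
`v ++ [true]`; `label v = none` means that `v` is not in the domain. The empty tree is allowed. -/
@[ext]
structure LTree (A : Type*) where
  label : List Bool → Option A
  prefix_closed : ∀ (v : List Bool) (d : Bool),
    (label (v ++ [d])).isSome = true → (label v).isSome = true

/-- A multi-context over `A`: a tree over `A ∪ {⋆}` in which `⋆` labels only leaves.
The alphabet `A ∪ {⋆}` is `Option A`, with `none` in the role of `⋆`. -/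
structure MultiContext (A : Type*) extends LTree (Option A) where
  port_leaf : ∀ (v : List Bool) (d : Bool),
    label v = some none → label (v ++ [d]) = none

namespace MultiContext

variable {A : Type*}

/-- The label of the node `done ++ rest` in `c[η]`, read from the node `done` downwards, when no
proper ancestor of `done` is a port: from a port on, one reads the inserted tree. -/
def plugLabel (c : MultiContext A) (η : List Bool → LTree A) :
    List Bool → List Bool → Option A
  | done, [] =>
    match c.label done with
    | some none => (η done).label []
    | some (some a) => some a
    | none => none
  | done, d :: rest =>
    match c.label done with
    | some none => (η done).label (d :: rest)
    | some (some _) => plugLabel c η (done ++ [d]) rest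
    | none => none

theorem plugLabel_prefix_closed (c : MultiContext A) (η : List Bool → LTree A) (d : Bool) :
    ∀ rest done : List Bool, (c.plugLabel η done (rest ++ [d])).isSome = true →
      (c.plugLabel η done rest).isSome = true := by
  intro rest
  induction rest with
  | nil =>
    intro done h
    rw [List.nil_append] at h
    unfold plugLabel at h ⊢
    rcases hc : c.label done with _ | _ | a
    · simp [hc] at h
    · simp only [hc] at h ⊢
      exact (η done).prefix_closed [] d h
    · simp
  | cons e rest ih =>
    intro done h
    rw [List.cons_append] at h
    unfold plugLabel at h ⊢
    rcases hc : c.label done with _ | _ | a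
    · simp [hc] at h
    · simp only [hc] at h ⊢
      exact (η done).prefix_closed (e :: rest) d h
    · simp only [hc] at h ⊢
      exact ih (done ++ [e]) h

/-- `c[η]`: the tree obtained from `c` by inserting the tree `η x` into every port `x`. The
values of `η` at words that are not ports of `c` play no role. -/
def plug (c : MultiContext A) (η : List Bool → LTree A) : LTree A where
  label v := c.plugLabel η [] v
  prefix_closed v d h := c.plugLabel_prefix_closed η d v [] h

/-- `c[T_A]`: the set of all trees over `A` that extend `c`. -/
def extensions (c : MultiContext A) : Set (LTree A) :=
  {t | ∃ η : List Bool → LTree A, c.plug η = t}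

/-- `[c]⁻¹L`: the set of the trees in `L` that extend `c`. -/
def restrict (c : MultiContext A) (L : Set (LTree A)) : Set (LTree A) :=
  {t | t ∈ L ∧ t ∈ c.extensions}

end MultiContext

/-- A prefix over `A`: a finite multi-context. -/
structure TreePrefix (A : Type*) extends MultiContext A where
  finite_dom : {v : List Bool | (label v).isSome = true}.Finite

/-- The prefix topology on trees, with basic open sets `p[T_A]` for prefixes `p`. -/
instance instTopologicalSpaceLTree (A : Type*) : TopologicalSpace (LTree A) :=
  TopologicalSpace.generateFrom
    {U | ∃ p : TreePrefix A, U = p.toMultiContext.extensions}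

section Wadge

/-- Wadge reducibility `L ≤_W M`: `L` is the preimage of `M` under a continuous map. -/
def WadgeLE {X Y : Type*} [TopologicalSpace X] [TopologicalSpace Y]
    (L : Set X) (M : Set Y) : Prop :=
  ∃ f : X → Y, Continuous f ∧ L = f ⁻¹' M

/-- Strict Wadge reducibility `L <_W M`. -/
def WadgeLT {X Y : Type*} [TopologicalSpace X] [TopologicalSpace Y]
    (L : Set X) (M : Set Y) : Prop :=
  WadgeLE L M ∧ ¬ WadgeLE M L

/-- `L` is self dual: it is Wadge equivalent to its complement. -/
def SelfDual {X : Type*} [TopologicalSpace X] (L : Set X) : Prop :=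
  WadgeLE L Lᶜ ∧ WadgeLE Lᶜ L

/-- `M` is a non self dual set strictly below `L`. -/
def NsdBelow {X : Type*} [TopologicalSpace X] (M L : Set X) : Prop :=
  ¬ SelfDual M ∧ WadgeLT M L

open Classical in
/-- The Wadge degree of `L`. It is the ordinal defined by recursion along `<_W` over the non self
dual sets: `∅` and the whole space have degree `1`; above them, a non self dual `L` has degree
`sup {d(M) + 1}` and a self dual `L` has degree `sup {d(M)}`, with `M` ranging over the non self
dual sets strictly below `L`. (`Acc.rank` starts with `0`, and `1 + rank` starts with `1`.)
On Borel sets, where `<_W` is well-founded, the degree is always an ordinal. The value `⊤` is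
given to those sets below which `<_W` is not well-founded, so that no ordinal is assigned. -/
noncomputable def wadgeDegree {X : Type*} [TopologicalSpace X] (L : Set X) : WithTop Ordinal :=
  if h : Acc NsdBelow L then
    if SelfDual L then
      ((⨆ M : {M : Set X // NsdBelow M L}, (1 + (h.inv M.2).rank) : Ordinal) : WithTop Ordinal)
    else ((1 + h.rank : Ordinal) : WithTop Ordinal)
  else ⊤

end Wadge

section CuttingGame

variable {A : Type*}

/-- A strategy of Alternator: given the moves made so far (in each completed round, the tree that
Alternator chose and the prefix that Constrainer chose), it names Alternator's next tree. -/
def AlternatorStrategy (A : Type*) : Type _ :=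
  List (LTree A × TreePrefix A) → LTree A

/-- The first `n` rounds of the play in which Alternator follows `σ` and Constrainer chooses the
prefixes `c 0, c 1, …`. -/
def AlternatorStrategy.history (σ : AlternatorStrategy A) (c : ℕ → TreePrefix A) :
    ℕ → List (LTree A × TreePrefix A)
  | 0 => []
  | n + 1 => history σ c n ++ [(σ (history σ c n), c n)]

/-- The tree that Alternator chooses in round `n` (counted from `0`) of that play. -/
def AlternatorStrategy.move (σ : AlternatorStrategy A) (c : ℕ → TreePrefix A) (n : ℕ) :
    LTree A :=
  σ (σ.history c n)

/-- The prefix that Alternator has to extend in round `n`: the given prefix `p` in the first round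
and Constrainer's preceding choice afterwards. -/
def constraint (p : TreePrefix A) (c : ℕ → TreePrefix A) : ℕ → TreePrefix A
  | 0 => p
  | n + 1 => c n

/-- `σ` wins the infinite cutting game `H^p_∞(K 0, K 1, …)` for Alternator: as long as each choice
of Constrainer is a prefix of Alternator's preceding tree, `σ` provides a legal move, that is, a
tree in `K n` which extends the prefix required in round `n`. -/
def IsWinningInfinite (p : TreePrefix A) (K : ℕ → Set (LTree A))
    (σ : AlternatorStrategy A) : Prop :=
  ∀ (c : ℕ → TreePrefix A) (n : ℕ),
    (∀ i < n, σ.move c i ∈ (c i).toMultiContext.extensions) →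
      σ.move c n ∈ K n ∧ σ.move c n ∈ (constraint p c n).toMultiContext.extensions

/-- Alternator has a winning strategy in the infinite cutting game `H^p_∞(K 0, K 1, …)`. -/
def AlternatorWinsInfinite (p : TreePrefix A) (K : ℕ → Set (LTree A)) : Prop :=
  ∃ σ : AlternatorStrategy A, IsWinningInfinite p K σ

/-- The sequence of languages `L, M, L, M, …`. -/
def alternating (L M : Set (LTree A)) (n : ℕ) : Set (LTree A) :=
  if Even n then L else M

end CuttingGame

end TreeLang

/-!
The proof is topological. Put `E 0 L` for the whole space and, recursively, let `E α L`
(`altDeriv`) be the intersection over `β < α` of the closures of `L ∩ E β Lᶜ`. So `E α L` is where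
`α` alternations between `L` and `Lᶜ`, starting in `L`, are possible arbitrarily closely. There are
two kinds of sets.

* If `E γ L = E γ Lᶜ = ∅` for some `γ`, then the alternations that `L` offers determine how it
  compares with other sets: `L ≤_W M` as soon as `M` offers at least as many, from both sides
  (`wadgeLE_of_altDeriv_nonempty`). The reduction is built by induction on `γ`: the points where a
  maximal number of alternations is possible form a closed set that lies on one side, so they may
  all be mapped to one point of `M`, and the rest is a disjoint union of clopen sets with fewer
  alternations, mapped into shrinking neighbourhoods of that point. It follows that the least `α`
  for which `E (α + 1) L` or `E (α + 1) Lᶜ` is empty strictly increases along `<_W` from a non self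
  dual set (`alternationRank_lt`). Hence the Wadge degree is countable if `γ` is
  (`wadgeDegree_lt_omega_one`).
* Otherwise, since the topology has a countable basis, both sequences of derivatives stop
  decreasing before `ω₁`, at one and the same nonempty closed set, in which both `L` and `Lᶜ` are
  dense (`altDeriv_eq_empty_or_exists_dense`). A nonempty set in which both are dense meets all
  derivatives, so every set with vanishing derivatives reduces to `L`. There are sets with each
  countable number of alternations (`exists_alternation`), they form a chain of non self dual sets
  strictly below `L`, and the degree of `L` is at least `ω₁` (`omega_one_le_wadgeDegree`).

A nonempty set of extensions of `p` in which `L` and `Lᶜ` are dense is exactly what Alternator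
needs: she wins by always moving inside it (`alternatorWins_of_dense`), and conversely the moves of
a winning strategy form such a set (`exists_dense_of_alternatorWins`).
-/

open Set Topology Filter TopologicalSpace
open scoped Ordinal Cardinal

namespace TreeLang

universe u v

/-! ### Alternating derivatives -/

section AltDeriv

variable {X Y : Type*} [TopologicalSpace X] [TopologicalSpace Y]

/-- The `α`-th alternating derivative of `L`: the set of the points in each neighbourhood of which
one can alternate between `L` and its complement along every descending sequence of ordinals below
`α`, starting in `L`. In particular the `0`-th derivative is the whole space, and the
`(α + 1)`-st one is the closure of the part of `L` that lies in the `α`-th derivative of `Lᶜ`. -/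
noncomputable def altDeriv (α : Ordinal.{v}) (L : Set X) : Set X :=
  ⋂ β : Iio α, closure (L ∩ altDeriv β.1 Lᶜ)
termination_by α
decreasing_by exact β.2

theorem mem_altDeriv {α : Ordinal.{v}} {L : Set X} {x : X} :
    x ∈ altDeriv α L ↔ ∀ β < α, x ∈ closure (L ∩ altDeriv β Lᶜ) := by
  rw [altDeriv]
  simp

theorem isClosed_altDeriv (α : Ordinal.{v}) (L : Set X) : IsClosed (altDeriv α L) := by
  rw [altDeriv]
  exact isClosed_iInter fun _ => isClosed_closure

theorem altDeriv_anti {α β : Ordinal.{v}} (h : α ≤ β) (L : Set X) :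
    altDeriv β L ⊆ altDeriv α L := fun _ hx =>
  mem_altDeriv.2 fun γ hγ => mem_altDeriv.1 hx γ (hγ.trans_le h)

theorem mem_altDeriv_add_one {α : Ordinal.{v}} {L : Set X} {x : X} :
    x ∈ altDeriv (α + 1) L ↔ x ∈ closure (L ∩ altDeriv α Lᶜ) := by
  refine ⟨fun h => mem_altDeriv.1 h α (lt_add_one α), fun h => mem_altDeriv.2 fun β hβ => ?_⟩
  exact closure_mono (inter_subset_inter_right _ (altDeriv_anti (Order.lt_add_one_iff.1 hβ) _)) h

theorem mem_altDeriv_of_mem {α : Ordinal.{v}} {L : Set X} {x : X} (hx : x ∈ L)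
    (h : x ∈ altDeriv α Lᶜ) : x ∈ altDeriv (α + 1) L :=
  mem_altDeriv_add_one.2 (subset_closure ⟨hx, h⟩)

/-- If a point is in neither `(α + 1)`-st derivative then it is already missing in one of the
derivatives at a successor `δ + 1 ≤ α`: were it in the `α`-th derivative of the side that it
is not on, it would be in the `(α + 1)`-st derivative of its own side. -/
theorem exists_notMem_altDeriv_add_one {α : Ordinal.{v}} {L : Set X} {x : X}
    (h : x ∉ altDeriv (α + 1) L) (h' : x ∉ altDeriv (α + 1) Lᶜ) :
    ∃ δ < α, x ∉ altDeriv (δ + 1) L ∨ x ∉ altDeriv (δ + 1) Lᶜ := by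
  by_cases hx : x ∈ L
  · have h2 : x ∉ altDeriv α Lᶜ := fun h2 => h (mem_altDeriv_of_mem hx h2)
    rw [mem_altDeriv] at h2
    push Not at h2
    obtain ⟨δ, hδ, h3⟩ := h2
    exact ⟨δ, hδ, Or.inr fun h4 => h3 (mem_altDeriv_add_one.1 h4)⟩
  · have h2 : x ∉ altDeriv α L := fun h2 =>
      h' (mem_altDeriv_of_mem hx (by rwa [compl_compl]))
    rw [mem_altDeriv] at h2
    push Not at h2
    obtain ⟨δ, hδ, h3⟩ := h2
    exact ⟨δ, hδ, Or.inl fun h4 => h3 (mem_altDeriv_add_one.1 h4)⟩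

/-- A continuous map that reduces `N` to `K` on an open set `U` maps the derivatives of `N`
inside `U` into those of `K`. -/
theorem map_mem_altDeriv {f : X → Y} (hf : Continuous f) {U : Set X} (hU : IsOpen U)
    (α : Ordinal.{v}) : ∀ {N : Set X} {K : Set Y}, (∀ x ∈ U, x ∈ N ↔ f x ∈ K) →
    ∀ x ∈ U, x ∈ altDeriv α N → f x ∈ altDeriv α K := by
  induction α using WellFoundedLT.induction with
  | ind α ih =>
    intro N K h x hxU hx
    refine mem_altDeriv.2 fun β hβ => ?_
    have h1 : x ∈ closure (U ∩ (N ∩ altDeriv β Nᶜ)) :=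
      hU.inter_closure ⟨hxU, mem_altDeriv.1 hx β hβ⟩
    refine map_mem_closure hf h1 ?_
    rintro z ⟨hzU, hzN, hz⟩
    exact ⟨(h z hzU).1 hzN, ih β hβ (fun w hw => not_congr (h w hw)) z hzU hz⟩

/-- A set that is contained in the closures of both its intersection with `L` and its
intersection with the complement survives in all derivatives. -/
theorem subset_altDeriv {L S : Set X} (h : S ⊆ closure (S ∩ L)) (h' : S ⊆ closure (S ∩ Lᶜ))
    (α : Ordinal.{v}) : S ⊆ altDeriv α L := by
  induction α using WellFoundedLT.induction generalizing L with
  | ind α ih =>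
    intro x hx
    refine mem_altDeriv.2 fun β hβ => closure_mono ?_ (h hx)
    rintro z ⟨hzS, hzL⟩
    exact ⟨hzL, ih β hβ h' (by rwa [compl_compl]) hzS⟩

theorem altDeriv_nonempty_of_wadgeLE {L : Set X} {M : Set Y} (h : WadgeLE L M)
    {α : Ordinal.{v}} (hα : (altDeriv α L).Nonempty) : (altDeriv α M).Nonempty := by
  obtain ⟨f, hf, rfl⟩ := h
  obtain ⟨x, hx⟩ := hα
  exact ⟨f x, map_mem_altDeriv hf isOpen_univ α (fun _ _ => Iff.rfl) x trivial hx⟩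

theorem WadgeLE.compl {L : Set X} {M : Set Y} (h : WadgeLE L M) : WadgeLE Lᶜ Mᶜ := by
  obtain ⟨f, hf, rfl⟩ := h
  exact ⟨f, hf, rfl⟩

end AltDeriv

/-! ### Wadge reductions from alternations -/

section Reduction

variable {X Y : Type*} [TopologicalSpace X] [TopologicalSpace Y]

/-- The open set `V` offers at least the alternations between `M` and its complement that `U`
offers between `L` and its complement, from both starting sides. Only successor ordinals are
compared, since the nonemptiness of a derivative at a limit would need compactness. -/
def Dominates (L U : Set X) (M V : Set Y) : Prop :=
  ∀ β : Ordinal.{v},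
    ((U ∩ altDeriv (β + 1) L).Nonempty → (V ∩ altDeriv (β + 1) M).Nonempty) ∧
      ((U ∩ altDeriv (β + 1) Lᶜ).Nonempty → (V ∩ altDeriv (β + 1) Mᶜ).Nonempty)

theorem Dominates.compl {L U : Set X} {M V : Set Y} (h : Dominates.{v} L U M V) :
    Dominates.{v} Lᶜ U Mᶜ V := fun β => by
  rw [compl_compl, compl_compl]
  exact (h β).symm

/-- The maps `f k` on disjoint clopen sets `U k` glue to a continuous map that takes the value `y`
elsewhere, if the images of the `U k` converge to `y`. -/
theorem exists_continuousOn_glue {U : ℕ → Set X} (hU : ∀ k, IsClopen (U k))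
    (hd : Pairwise (Function.onFun Disjoint U)) {f : ℕ → X → Y}
    (hf : ∀ k, ContinuousOn (f k) (U k)) (y : Y) {D : Set X}
    (hy : ∀ x ∈ D, x ∉ ⋃ k, U k → ∀ O ∈ 𝓝 y, ∀ᶠ k in atTop, MapsTo (f k) (U k) O) :
    ∃ g : X → Y, ContinuousOn g D ∧ (∀ k, EqOn g (f k) (U k)) ∧
      ∀ x ∉ ⋃ k, U k, g x = y := by
  classical
  let g : X → Y := fun x => if h : ∃ k, x ∈ U k then f h.choose x else y
  have hg : ∀ k, EqOn g (f k) (U k) := by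
    intro k x hx
    have h : ∃ k, x ∈ U k := ⟨k, hx⟩
    have hk : h.choose = k := by
      by_contra hne
      exact (hd hne).le_bot ⟨h.choose_spec, hx⟩
    simp only [g, dif_pos h, hk]
  have hg' : ∀ x ∉ ⋃ k, U k, g x = y := by
    intro x hx
    have h : ¬ ∃ k, x ∈ U k := by simpa using hx
    simp only [g, dif_neg h]
  refine ⟨g, fun x hxD => ContinuousAt.continuousWithinAt ?_, hg, hg'⟩
  by_cases hx : x ∈ ⋃ k, U k
  · obtain ⟨k, hk⟩ := mem_iUnion.1 hx
    have hn : U k ∈ 𝓝 x := (hU k).isOpen.mem_nhds hk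
    exact ((hf k).continuousAt hn).congr ((hg k).symm.eventuallyEq_of_mem hn)
  · rw [ContinuousAt, hg' x hx]
    intro O hO
    obtain ⟨m, hm⟩ := eventually_atTop.1 (hy x hxD hx O hO)
    have hcl : IsClosed (⋃ k ∈ Finset.range m, U k) :=
      isClosed_biUnion_finset fun k _ => (hU k).isClosed
    have hn : (⋃ k ∈ Finset.range m, U k)ᶜ ∈ 𝓝 x :=
      hcl.isOpen_compl.mem_nhds fun h => by
        obtain ⟨k, _, hk⟩ := mem_iUnion₂.1 h
        exact hx (mem_iUnion.2 ⟨k, hk⟩)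
    change ∀ᶠ z in 𝓝 x, g z ∈ O
    filter_upwards [hn] with z hz
    by_cases hzU : z ∈ ⋃ k, U k
    · obtain ⟨k, hk⟩ := mem_iUnion.1 hzU
      have hmk : m ≤ k := by
        by_contra hlt
        exact hz (mem_iUnion₂.2 ⟨k, Finset.mem_range.2 (not_le.1 hlt), hk⟩)
      rw [hg k hk]
      exact hm k hmk hk
    · rw [hg' z hzU]
      exact mem_of_mem_nhds hO

theorem exists_clopen_nhds_seq {c : ℕ → Set Y} (hc : ∀ n, IsClopen (c n))
    (hb : IsTopologicalBasis (range c)) {y : Y} {V : Set Y} (hV : IsClopen V) (hy : y ∈ V) :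
    ∃ W : ℕ → Set Y, (∀ k, IsClopen (W k)) ∧ (∀ k, y ∈ W k) ∧ (∀ k, W k ⊆ V) ∧
      ∀ O ∈ 𝓝 y, ∀ᶠ k in atTop, W k ⊆ O := by
  classical
  refine ⟨fun k => V ∩ ⋂ i ∈ (Finset.range k).filter (fun i => y ∈ c i), c i, fun k => ?_,
    fun k => ?_, fun k => inter_subset_left, fun O hO => ?_⟩
  · exact hV.inter (isClopen_biInter_finset fun i _ => hc i)
  · exact ⟨hy, mem_iInter₂.2 fun i hi => (Finset.mem_filter.1 hi).2⟩
  · obtain ⟨_, ⟨n, rfl⟩, hyn, hnO⟩ := hb.mem_nhds_iff.1 hO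
    filter_upwards [eventually_gt_atTop n] with k hk
    refine fun z hz => hnO (mem_iInter₂.1 hz.2 n ?_)
    exact Finset.mem_filter.2 ⟨Finset.mem_range.2 hk, hyn⟩

/-- The reduction on a clopen set `U` that offers at most `γ` alternations from the side of `Lᶜ`.
The points of the `(γ + 1)`-st derivative of `L` are in `L`, and are all mapped to one point `y` of
`M` from which `γ` more alternations are possible in `M`; the rest of `U` is a disjoint
union of clopen sets that offer fewer alternations, which are mapped into shrinking
neighbourhoods of `y`. -/
theorem exists_reduction_on [Nonempty Y] {c : ℕ → Set X} (hc : ∀ n, IsClopen (c n))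
    (hb : IsTopologicalBasis (range c)) {c' : ℕ → Set Y} (hc' : ∀ n, IsClopen (c' n))
    (hb' : IsTopologicalBasis (range c')) (γ : Ordinal.{v}) :
    ∀ (L : Set X) (M : Set Y) (U : Set X) (V : Set Y), IsClopen U → IsClopen V →
      U ∩ altDeriv (γ + 1) Lᶜ = ∅ → Dominates.{v} L U M V →
      ∃ f : X → Y, ContinuousOn f U ∧ MapsTo f U V ∧ ∀ x ∈ U, x ∈ L ↔ f x ∈ M := by
  classical
  induction γ using WellFoundedLT.induction with
  | ind γ ih =>
    intro L M U V hU hV hγ hdom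
    -- The induction hypothesis does not depend on which of the two sides is exhausted first.
    have ih' : ∀ δ < γ, ∀ (U' : Set X) (V' : Set Y), IsClopen U' → IsClopen V' →
        (U' ∩ altDeriv (δ + 1) L = ∅ ∨ U' ∩ altDeriv (δ + 1) Lᶜ = ∅) → Dominates.{v} L U' M V' →
        ∃ f : X → Y, ContinuousOn f U' ∧ MapsTo f U' V' ∧ ∀ x ∈ U', x ∈ L ↔ f x ∈ M := by
      rintro δ hδ U' V' hU' hV' (h | h) hd
      · obtain ⟨f, h1, h2, h3⟩ :=
          ih δ hδ Lᶜ Mᶜ U' V' hU' hV' (by rwa [compl_compl]) hd.compl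
        exact ⟨f, h1, h2, fun x hx => not_iff_not.1 (h3 x hx)⟩
      · exact ih δ hδ L M U' V' hU' hV' h hd
    set C : Set X := U ∩ altDeriv (γ + 1) L with hC
    have hCL : C ⊆ L := by
      rintro x ⟨hxU, hx⟩
      by_contra hxL
      refine (Set.ext_iff.1 hγ x).1 ⟨hxU, ?_⟩
      exact mem_altDeriv_of_mem hxL (by
        rw [compl_compl]; exact altDeriv_anti (le_add_of_nonneg_right zero_le_one) L hx)
    -- The target point `y`, with the neighbourhoods into which the pieces are mapped.
    obtain ⟨y, W, hW, hWV, hWdom, hyC, hWlim⟩ : ∃ (y : Y) (W : ℕ → Set Y),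
        (∀ k, IsClopen (W k)) ∧ (∀ k, W k ⊆ V) ∧
        (∀ k, ∀ U' ⊆ U, U' ∩ C = ∅ → Dominates.{v} L U' M (W k)) ∧
        (C.Nonempty → y ∈ V ∧ y ∈ M) ∧
        (C.Nonempty → ∀ O ∈ 𝓝 y, ∀ᶠ k in atTop, W k ⊆ O) := by
      by_cases hne : C.Nonempty
      · obtain ⟨z, hzV, hz⟩ := (hdom γ).1 hne
        obtain ⟨y, hyV, hyM, hy⟩ :=
          mem_closure_iff.1 (mem_altDeriv_add_one.1 hz) V hV.isOpen hzV
        obtain ⟨W, h1, h2, h3, h4⟩ := exists_clopen_nhds_seq hc' hb' hV hyV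
        refine ⟨y, W, h1, h3, fun k U' hU' hU'C β => ?_, fun _ => ⟨hyV, hyM⟩, fun _ => h4⟩
        have key : ∀ N : Set X, U' ∩ altDeriv (γ + 1) N = ∅ →
            (U' ∩ altDeriv (β + 1) N).Nonempty → β + 1 ≤ γ := by
          rintro N hN ⟨x, hx, hxN⟩
          by_contra hlt
          rw [Order.add_one_le_iff, not_lt] at hlt
          exact (Set.ext_iff.1 hN x).1
            ⟨hx, altDeriv_anti (add_le_add_left hlt 1) N hxN⟩
        constructor
        · intro hx
          have hβ : β + 1 ≤ γ := key L (by
            rw [← hU'C, hC, ← inter_assoc, inter_eq_self_of_subset_left hU']) hx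
          exact ⟨y, h2 k, altDeriv_anti (hβ.trans (le_add_of_nonneg_right zero_le_one)) M
            (mem_altDeriv_of_mem hyM hy)⟩
        · intro hx
          have hβ : β + 1 ≤ γ := key Lᶜ
            (subset_empty_iff.1 (hγ ▸ inter_subset_inter_left _ hU')) hx
          exact ⟨y, h2 k, altDeriv_anti hβ _ hy⟩
      · refine ⟨Classical.arbitrary Y, fun _ => V, fun _ => hV, fun _ => Subset.rfl, ?_,
          fun h => absurd h hne, fun h => absurd h hne⟩
        intro _ U' hU' _ β
        exact ⟨fun h => (hdom β).1 (h.mono (inter_subset_inter_left _ hU')),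
          fun h => (hdom β).2 (h.mono (inter_subset_inter_left _ hU'))⟩
    -- The basic clopen subsets of `U` that offer fewer alternations cover `U \ C`.
    let G : ℕ → Prop := fun k => c k ⊆ U ∧ c k ∩ C = ∅ ∧
      ∃ δ < γ, c k ∩ altDeriv (δ + 1) L = ∅ ∨ c k ∩ altDeriv (δ + 1) Lᶜ = ∅
    let B : ℕ → Set X := fun k => if G k then c k else ∅
    have hB : ∀ k, IsClopen (B k) := fun k => by
      by_cases hk : G k
      · simpa only [B, if_pos hk] using hc k
      · simpa only [B, if_neg hk] using isClopen_empty
    have hcov : ∀ x ∈ U, x ∉ C → ∃ k, x ∈ B k := by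
      intro x hxU hxC
      obtain ⟨δ, hδ, hx⟩ := exists_notMem_altDeriv_add_one (L := L)
        (fun h => hxC ⟨hxU, h⟩) (fun h => (Set.ext_iff.1 hγ x).1 ⟨hxU, h⟩)
      have hCc : IsClosed C := hU.isClosed.inter (isClosed_altDeriv _ _)
      have hn : U ∩ Cᶜ ∈ 𝓝 x :=
        (hU.isOpen.inter hCc.isOpen_compl).mem_nhds ⟨hxU, hxC⟩
      have key : ∀ N : Set X, x ∉ altDeriv (δ + 1) N →
          ∃ k, x ∈ c k ∧ c k ⊆ U ∧ c k ∩ C = ∅ ∧ c k ∩ altDeriv (δ + 1) N = ∅ := by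
        intro N hN
        obtain ⟨_, ⟨k, rfl⟩, hxk, hk⟩ := hb.mem_nhds_iff.1
          (inter_mem hn ((isClosed_altDeriv (δ + 1) N).isOpen_compl.mem_nhds hN))
        exact ⟨k, hxk, fun z hz => (hk hz).1.1,
          eq_empty_of_forall_notMem fun z hz => (hk hz.1).1.2 hz.2,
          eq_empty_of_forall_notMem fun z hz => (hk hz.1).2 hz.2⟩
      rcases hx with hx | hx
      · obtain ⟨k, h1, h2, h3, h4⟩ := key L hx
        exact ⟨k, by simpa only [B, if_pos (show G k from ⟨h2, h3, δ, hδ, Or.inl h4⟩)] using h1⟩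
      · obtain ⟨k, h1, h2, h3, h4⟩ := key Lᶜ hx
        exact ⟨k, by simpa only [B, if_pos (show G k from ⟨h2, h3, δ, hδ, Or.inr h4⟩)] using h1⟩
    have hDB : ∀ k, disjointed B k ⊆ B k := disjointed_le B
    have hDcl : ∀ k, IsClopen (disjointed B k) := fun k =>
      disjointedRec (fun _ _ h => h.diff (hB _)) (hB k)
    have hBU : ∀ k, B k ⊆ U ∧ B k ∩ C = ∅ := fun k => by
      by_cases hk : G k
      · simpa only [B, if_pos hk] using ⟨hk.1, hk.2.1⟩
      · simp only [B, if_neg hk, empty_subset, empty_inter, and_self]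
    have hpiece : ∀ k, ∃ f : X → Y, ContinuousOn f (disjointed B k) ∧
        MapsTo f (disjointed B k) (W k) ∧ ∀ x ∈ disjointed B k, x ∈ L ↔ f x ∈ M := by
      intro k
      by_cases hk : G k
      · have hDk : disjointed B k ⊆ c k := by simpa only [B, if_pos hk] using hDB k
        obtain ⟨h1, h2, δ, hδ, h3⟩ := hk
        refine ih' δ hδ _ _ (hDcl k) (hW k) (h3.imp ?_ ?_)
          (hWdom k _ (hDk.trans h1) (subset_empty_iff.1 (h2 ▸ inter_subset_inter_left _ hDk)))
        · exact fun h => subset_empty_iff.1 (h ▸ inter_subset_inter_left _ hDk)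
        · exact fun h => subset_empty_iff.1 (h ▸ inter_subset_inter_left _ hDk)
      · have hDk : ∀ x, x ∉ disjointed B k := fun x hx => by
          have := hDB k hx
          simp only [B, if_neg hk, mem_empty_iff_false] at this
        exact ⟨fun _ => y, continuousOn_const, fun x hx => absurd hx (hDk x),
          fun x hx => absurd hx (hDk x)⟩
    choose f hf hfW hfL using hpiece
    have hmem : ∀ x ∈ U, x ∉ ⋃ k, disjointed B k → x ∈ C := by
      intro x hxU hx
      by_contra hxC
      obtain ⟨k, hk⟩ := hcov x hxU hxC
      rw [iUnion_disjointed] at hx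
      exact hx (mem_iUnion.2 ⟨k, hk⟩)
    obtain ⟨g, hg, hgf, hgy⟩ := exists_continuousOn_glue hDcl (disjoint_disjointed B) hf y
      (D := U) fun x hxU hx O hO => by
        filter_upwards [hWlim ⟨x, hmem x hxU hx⟩ O hO] with k hk
        exact (hfW k).mono_right hk
    refine ⟨g, hg, fun x hxU => ?_, fun x hxU => ?_⟩
    · by_cases hx : x ∈ ⋃ k, disjointed B k
      · obtain ⟨k, hk⟩ := mem_iUnion.1 hx
        rw [hgf k hk]
        exact hWV k (hfW k hk)
      · rw [hgy x hx]
        exact (hyC ⟨x, hmem x hxU hx⟩).1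
    · by_cases hx : x ∈ ⋃ k, disjointed B k
      · obtain ⟨k, hk⟩ := mem_iUnion.1 hx
        rw [hgf k hk]
        exact hfL k x hk
      · rw [hgy x hx]
        exact iff_of_true (hCL (hmem x hxU hx)) (hyC ⟨x, hmem x hxU hx⟩).2

/-- A set whose derivatives become empty is Wadge reducible to every set that offers at least the
same alternations. -/
theorem wadgeLE_of_altDeriv_nonempty [Nonempty Y] {c : ℕ → Set X} (hc : ∀ n, IsClopen (c n))
    (hb : IsTopologicalBasis (range c)) {c' : ℕ → Set Y} (hc' : ∀ n, IsClopen (c' n))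
    (hb' : IsTopologicalBasis (range c')) {L : Set X} {M : Set Y} {γ : Ordinal.{v}}
    (hγ : altDeriv γ Lᶜ = ∅)
    (h : ∀ β : Ordinal.{v}, (altDeriv (β + 1) L).Nonempty → (altDeriv (β + 1) M).Nonempty)
    (h' : ∀ β : Ordinal.{v}, (altDeriv (β + 1) Lᶜ).Nonempty → (altDeriv (β + 1) Mᶜ).Nonempty) :
    WadgeLE L M := by
  obtain ⟨f, hf, -, hfL⟩ := exists_reduction_on hc hb hc' hb' γ L M univ univ isClopen_univ
    isClopen_univ
    (by
      rw [univ_inter]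
      exact subset_empty_iff.1 (hγ ▸ altDeriv_anti (le_add_of_nonneg_right zero_le_one) _))
    (fun β => by simpa only [univ_inter] using ⟨h β, h' β⟩)
  exact ⟨f, continuousOn_univ.1 hf, Set.ext fun x => hfL x trivial⟩

end Reduction

/-! ### Wadge degrees and countable derivatives -/

section Rank

theorem add_lt_omega_one {α β : Ordinal.{v}} (h : α < ω₁) (h' : β < ω₁) : α + β < ω₁ :=
  Ordinal.isPrincipal_add_omega 1 h h'

theorem countable_Iio_of_lt_omega_one {α : Ordinal.{v}} (h : α < ω₁) : Countable (Iio α) := by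
  have h1 : α.card ≤ ℵ₀ := by
    rwa [← Order.lt_succ_iff, Cardinal.succ_aleph0, ← Cardinal.lt_omega_iff_card_lt]
  rwa [← Cardinal.mk_le_aleph0_iff, Cardinal.mk_Iio_ordinal, Cardinal.lift_le_aleph0]

variable {X : Type u} [TopologicalSpace X]

/-- The least `α` such that `α + 1` alternations are impossible from one of the two sides. -/
noncomputable def alternationRank (L : Set X) : Ordinal.{v} :=
  sInf {α | altDeriv (α + 1) L = ∅ ∨ altDeriv (α + 1) Lᶜ = ∅}

theorem alternationRank_le {L : Set X} {γ : Ordinal.{v}} (h : altDeriv γ L = ∅) :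
    alternationRank.{u, v} L ≤ γ :=
  csInf_le' (Or.inl (subset_empty_iff.1
    (h ▸ altDeriv_anti (le_add_of_nonneg_right zero_le_one) L)))

theorem altDeriv_eq_empty_of_le {L : Set X} {α β : Ordinal.{v}} (h : altDeriv α L = ∅)
    (hαβ : α ≤ β) : altDeriv β L = ∅ :=
  subset_empty_iff.1 (h ▸ altDeriv_anti hαβ L)

/-- One side can offer at most one alternation more than the other. -/
theorem altDeriv_add_two_eq_empty {L : Set X} {α : Ordinal.{v}}
    (h : altDeriv (α + 1) Lᶜ = ∅) : altDeriv (α + 1 + 1) L = ∅ := by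
  refine eq_empty_of_forall_notMem fun x hx => ?_
  rw [mem_altDeriv_add_one, h, inter_empty, closure_empty] at hx
  exact hx

theorem WadgeLE.altDeriv_eq_empty {L M : Set X} (h : WadgeLE M L) {γ : Ordinal.{v}}
    (hL : altDeriv γ L = ∅) : altDeriv γ M = ∅ := by
  rw [← not_nonempty_iff_eq_empty] at hL ⊢
  exact fun h' => hL (altDeriv_nonempty_of_wadgeLE h h')

/-- If the alternation ranks of `M ≤_W L` do not differ and `M` is not self dual, then `L` and `M`
have one and the same side that offers one alternation more, so they are equivalent. -/
theorem alternationRank_lt [Nonempty X] {c : ℕ → Set X} (hc : ∀ n, IsClopen (c n))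
    (hb : IsTopologicalBasis (range c)) {L M : Set X} (hM : NsdBelow M L) {γ : Ordinal.{v}}
    (hγ : altDeriv γ L = ∅) (hγ' : altDeriv γ Lᶜ = ∅) :
    alternationRank.{u, v} M < alternationRank.{u, v} L := by
  obtain ⟨hnsd, hML, hLM⟩ := hM
  by_contra hle
  rw [not_lt] at hle
  have hS : ∀ N : Set X, altDeriv γ N = ∅ →
      altDeriv (alternationRank.{u, v} N + 1) N = ∅ ∨
        altDeriv (alternationRank.{u, v} N + 1) Nᶜ = ∅ := fun N hN =>
    csInf_mem (s := {α | altDeriv (α + 1) N = ∅ ∨ altDeriv (α + 1) Nᶜ = ∅})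
      ⟨γ, Or.inl (altDeriv_eq_empty_of_le hN (le_add_of_nonneg_right zero_le_one))⟩
  set α : Ordinal.{v} := alternationRank.{u, v} M with hα
  have hMα := hS M (hML.altDeriv_eq_empty hγ)
  rw [← hα] at hMα
  have hLα : altDeriv (α + 1) L = ∅ ∨ altDeriv (α + 1) Lᶜ = ∅ :=
    (hS L hγ).imp (fun h => altDeriv_eq_empty_of_le h (add_le_add_left hle 1))
      (fun h => altDeriv_eq_empty_of_le h (add_le_add_left hle 1))
  have hlt : ∀ β < α, (altDeriv (β + 1) M).Nonempty ∧ (altDeriv (β + 1) Mᶜ).Nonempty := by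
    intro β hβ
    have := notMem_of_lt_csInf' (hα ▸ hβ)
    rw [mem_ofPred_eq, not_or] at this
    exact ⟨nonempty_iff_ne_empty.2 this.1, nonempty_iff_ne_empty.2 this.2⟩
  have hne : ∀ {N : Set X} {δ β : Ordinal.{v}}, altDeriv (δ + 1) N = ∅ →
      (altDeriv (β + 1) N).Nonempty → β < δ := by
    intro N δ β h hβ
    by_contra hlt
    exact hβ.ne_empty (altDeriv_eq_empty_of_le h (add_le_add_left (not_lt.1 hlt) 1))
  have hMγ : altDeriv γ M = ∅ := hML.altDeriv_eq_empty hγ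
  have hMγ' : altDeriv γ Mᶜ = ∅ := hML.compl.altDeriv_eq_empty hγ'
  -- At most one side of `M` is exhausted at `α + 1`, by non self duality.
  have hboth : ¬ (altDeriv (α + 1) M = ∅ ∧ altDeriv (α + 1) Mᶜ = ∅) := by
    rintro ⟨h1, h2⟩
    refine hnsd ⟨?_, ?_⟩
    · refine wadgeLE_of_altDeriv_nonempty hc hb hc hb hMγ' (fun β hβ => ?_) (fun β hβ => ?_)
      · exact (hlt β (hne h1 hβ)).2
      · rw [compl_compl]
        exact (hlt β (hne h2 hβ)).1
    · refine wadgeLE_of_altDeriv_nonempty hc hb hc hb (γ := γ) (by rwa [compl_compl])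
        (fun β hβ => ?_) (fun β hβ => ?_)
      · exact (hlt β (hne h2 hβ)).1
      · rw [compl_compl] at hβ
        exact (hlt β (hne h1 hβ)).2
  rcases hMα with h1 | h1
  · have h2 : altDeriv (α + 1) Mᶜ ≠ ∅ := fun h2 => hboth ⟨h1, h2⟩
    have h3 : altDeriv (α + 1) L = ∅ :=
      hLα.resolve_right fun h3 => h2 (hML.compl.altDeriv_eq_empty h3)
    have h4 : altDeriv (α + 1 + 1) Lᶜ = ∅ :=
      altDeriv_add_two_eq_empty (by rwa [compl_compl])
    refine hLM (wadgeLE_of_altDeriv_nonempty hc hb hc hb hγ' (fun β hβ => ?_) (fun β hβ => ?_))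
    · exact (hlt β (hne h3 hβ)).1
    · exact (nonempty_iff_ne_empty.2 h2).mono
        (altDeriv_anti (add_le_add_left (Order.lt_add_one_iff.1 (hne h4 hβ)) 1) _)
  · have h2 : altDeriv (α + 1) M ≠ ∅ := fun h2 => hboth ⟨h2, h1⟩
    have h3 : altDeriv (α + 1) Lᶜ = ∅ :=
      hLα.resolve_left fun h3 => h2 (hML.altDeriv_eq_empty h3)
    have h4 : altDeriv (α + 1 + 1) L = ∅ := altDeriv_add_two_eq_empty h3
    refine hLM (wadgeLE_of_altDeriv_nonempty hc hb hc hb hγ' (fun β hβ => ?_) (fun β hβ => ?_))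
    · exact (nonempty_iff_ne_empty.2 h2).mono
        (altDeriv_anti (add_le_add_left (Order.lt_add_one_iff.1 (hne h4 hβ)) 1) _)
    · exact (hlt β (hne h3 hβ)).2

theorem exists_acc_rank_le [Nonempty X] {c : ℕ → Set X} (hc : ∀ n, IsClopen (c n))
    (hb : IsTopologicalBasis (range c)) {γ : Ordinal.{u}} (α : Ordinal.{u}) :
    ∀ L : Set X, alternationRank.{u, u} L = α → altDeriv γ L = ∅ → altDeriv γ Lᶜ = ∅ →
      ∃ h : Acc NsdBelow L, h.rank ≤ α := by
  induction α using WellFoundedLT.induction with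
  | ind α ih =>
    intro L hL hγ hγ'
    have key : ∀ M : Set X, NsdBelow M L → ∃ h : Acc NsdBelow M, h.rank < α := by
      intro M hM
      have hlt : alternationRank.{u, u} M < α := hL ▸ alternationRank_lt hc hb hM hγ hγ'
      obtain ⟨h, hr⟩ := ih _ hlt M rfl (hM.2.1.altDeriv_eq_empty hγ)
        (hM.2.1.compl.altDeriv_eq_empty hγ')
      exact ⟨h, hr.trans_lt hlt⟩
    refine ⟨Acc.intro L fun M hM => (key M hM).1, ?_⟩
    rw [Acc.rank_eq]
    refine Ordinal.iSup_le fun M => Order.succ_le_of_lt ?_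
    exact (key M.1 M.2).2

theorem wadgeDegree_lt_omega_one [Nonempty X] {c : ℕ → Set X} (hc : ∀ n, IsClopen (c n))
    (hb : IsTopologicalBasis (range c)) {γ : Ordinal.{u}} (hγω : γ < ω₁) {L : Set X}
    (hγ : altDeriv γ L = ∅) (hγ' : altDeriv γ Lᶜ = ∅) :
    wadgeDegree L < ((ω₁ : Ordinal.{u}) : WithTop Ordinal.{u}) := by
  obtain ⟨h, hr⟩ := exists_acc_rank_le hc hb _ L rfl hγ hγ'
  have hrank : 1 + h.rank < ω₁ :=
    add_lt_omega_one (Ordinal.one_lt_omega0.trans Ordinal.omega0_lt_omega_one)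
      ((hr.trans (alternationRank_le hγ)).trans_lt hγω)
  rw [wadgeDegree, dif_pos h]
  split_ifs
  · refine WithTop.coe_lt_coe.2 (lt_of_le_of_lt (Ordinal.iSup_le fun M => ?_) hrank)
    exact add_le_add_right (h.rank_lt_of_rel M.2).le 1
  · exact WithTop.coe_lt_coe.2 hrank

/-- Below `ω₁` both sequences of derivatives become stationary: each basic open set that is
disjoint from some countable derivative is disjoint from it at an ordinal chosen for that basic
set, and countably many countable ordinals are bounded below `ω₁`. -/
theorem exists_altDeriv_stationary {c : ℕ → Set X} (hb : IsTopologicalBasis (range c))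
    (L : Set X) : ∃ γ < (ω₁ : Ordinal.{v}), altDeriv γ L ⊆ altDeriv (γ + 1) L ∧
      altDeriv γ Lᶜ ⊆ altDeriv (γ + 1) Lᶜ := by
  have key : ∀ N : Set X, ∃ γ < (ω₁ : Ordinal.{v}), ∀ δ < (ω₁ : Ordinal.{v}),
      altDeriv γ N ⊆ altDeriv δ N := by
    intro N
    have h : ∀ n, ∃ γ < (ω₁ : Ordinal.{v}), ∀ δ < (ω₁ : Ordinal.{v}),
        c n ∩ altDeriv δ N = ∅ → c n ∩ altDeriv γ N = ∅ := by
      intro n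
      by_cases h : ∃ γ < (ω₁ : Ordinal.{v}), c n ∩ altDeriv γ N = ∅
      · obtain ⟨γ, h1, h2⟩ := h
        exact ⟨γ, h1, fun _ _ _ => h2⟩
      · exact ⟨0, Ordinal.omega_pos 1, fun δ hδ hn => absurd ⟨δ, hδ, hn⟩ h⟩
    choose g hg hgN using h
    refine ⟨⨆ n, g n, Ordinal.iSup_lt_omega_one hg, fun δ hδ x hx => ?_⟩
    by_contra hxδ
    obtain ⟨_, ⟨n, rfl⟩, hxn, hn⟩ := hb.mem_nhds_iff.1
      ((isClosed_altDeriv δ N).isOpen_compl.mem_nhds hxδ)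
    have h1 : c n ∩ altDeriv δ N = ∅ :=
      eq_empty_of_forall_notMem fun z hz => hn hz.1 hz.2
    exact (Set.ext_iff.1 (hgN n δ hδ h1) x).1
      ⟨hxn, altDeriv_anti (Ordinal.le_iSup g n) N hx⟩
  obtain ⟨γ, hγ, h⟩ := key L
  obtain ⟨γ', hγ', h'⟩ := key Lᶜ
  have hm : max γ γ' < (ω₁ : Ordinal.{v}) := max_lt hγ hγ'
  have hm1 : max γ γ' + 1 < (ω₁ : Ordinal.{v}) :=
    add_lt_omega_one hm (Ordinal.one_lt_omega0.trans Ordinal.omega0_lt_omega_one)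
  exact ⟨max γ γ', hm, (altDeriv_anti (le_max_left _ _) L).trans (h _ hm1),
    (altDeriv_anti (le_max_right _ _) _).trans (h' _ hm1)⟩

/-- Either the derivatives vanish below `ω₁`, or there is a nonempty set in which both `L` and its
complement are dense. -/
theorem altDeriv_eq_empty_or_exists_dense {c : ℕ → Set X} (hb : IsTopologicalBasis (range c))
    (L : Set X) :
    (∃ γ < (ω₁ : Ordinal.{v}), altDeriv γ L = ∅ ∧ altDeriv γ Lᶜ = ∅) ∨
      ∃ S : Set X, S.Nonempty ∧ S ⊆ closure (S ∩ L) ∧ S ⊆ closure (S ∩ Lᶜ) := by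
  obtain ⟨γ, hγ, h, h'⟩ := exists_altDeriv_stationary.{u, v} hb L
  have h1 : altDeriv γ L ⊆ closure (altDeriv γ Lᶜ ∩ L) := fun x hx => by
    rw [inter_comm]
    exact mem_altDeriv_add_one.1 (h hx)
  have h2 : altDeriv γ Lᶜ ⊆ closure (altDeriv γ L ∩ Lᶜ) := fun x hx => by
    have := mem_altDeriv_add_one.1 (h' hx)
    rwa [compl_compl, inter_comm] at this
  have heq : altDeriv γ L = altDeriv γ Lᶜ :=
    Subset.antisymm
      (h1.trans (closure_minimal inter_subset_left (isClosed_altDeriv γ _)))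
      (h2.trans (closure_minimal inter_subset_left (isClosed_altDeriv γ _)))
  by_cases he : altDeriv γ L = ∅
  · exact Or.inl ⟨γ, hγ, he, heq ▸ he⟩
  · refine Or.inr ⟨altDeriv γ L, nonempty_iff_ne_empty.2 he, ?_, ?_⟩
    · conv_rhs => rw [heq]
      exact h1
    · conv_lhs => rw [heq]
      exact h2

/-- If there are sets of every countable alternation rank, then a set whose derivatives never
vanish has degree at least `ω₁`, since they all lie strictly below it and form a chain. -/
theorem omega_one_le_wadgeDegree [Nonempty X] {c : ℕ → Set X} (hc : ∀ n, IsClopen (c n))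
    (hb : IsTopologicalBasis (range c))
    (hex : ∀ α < (ω₁ : Ordinal.{u}), ∃ M : Set X,
      (altDeriv (α + 1) M).Nonempty ∧ altDeriv (α + 1) Mᶜ = ∅)
    {L : Set X} (hL : ∀ α : Ordinal.{u}, (altDeriv α L).Nonempty)
    (hL' : ∀ α : Ordinal.{u}, (altDeriv α Lᶜ).Nonempty) :
    ((ω₁ : Ordinal.{u}) : WithTop Ordinal.{u}) ≤ wadgeDegree L := by
  have hω1 : (1 : Ordinal.{u}) < ω₁ := Ordinal.one_lt_omega0.trans Ordinal.omega0_lt_omega_one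
  choose! M hM hM' using hex
  have hMnsd : ∀ α < (ω₁ : Ordinal.{u}), ¬ SelfDual (M α) := fun α hα h =>
    (altDeriv_nonempty_of_wadgeLE h.1 (hM α hα)).ne_empty (hM' α hα)
  have hML : ∀ α < (ω₁ : Ordinal.{u}), NsdBelow (M α) L := fun α hα =>
    ⟨hMnsd α hα, wadgeLE_of_altDeriv_nonempty hc hb hc hb (hM' α hα) (fun β _ => hL _)
      (fun β _ => hL' _), fun h =>
        (altDeriv_nonempty_of_wadgeLE h.compl (hL' (α + 1))).ne_empty (hM' α hα)⟩
  have hne : ∀ {N : Set X} {δ β : Ordinal.{u}}, altDeriv (δ + 1) N = ∅ →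
      (altDeriv (β + 1) N).Nonempty → β < δ := by
    intro N δ β h hβ
    by_contra hlt
    exact hβ.ne_empty (altDeriv_eq_empty_of_le h (add_le_add_left (not_lt.1 hlt) 1))
  have hMM : ∀ α β : Ordinal.{u}, α < β → β < ω₁ → NsdBelow (M α) (M β) := by
    intro α β hαβ hβ
    have hα := hαβ.trans hβ
    have h2 : altDeriv (α + 1 + 1) (M α) = ∅ := altDeriv_add_two_eq_empty (hM' α hα)
    refine ⟨hMnsd α hα, wadgeLE_of_altDeriv_nonempty hc hb hc hb (hM' α hα)
      (fun δ hδ => ?_) (fun δ hδ => ?_), fun h => ?_⟩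
    · exact (hM β hβ).mono (altDeriv_anti (add_le_add_left
        ((Order.lt_add_one_iff.1 (hne h2 hδ)).trans hαβ.le) 1) _)
    · obtain ⟨x, hx⟩ := hM β hβ
      obtain ⟨y, -, hy⟩ := closure_nonempty_iff.1 ⟨x, mem_altDeriv_add_one.1 hx⟩
      exact ⟨y, altDeriv_anti (Order.add_one_le_of_lt ((hne (hM' α hα) hδ).trans hαβ)) _ hy⟩
    · exact (lt_irrefl _ ((Order.lt_add_one_iff.1
        (hne h2 (altDeriv_nonempty_of_wadgeLE h (hM β hβ)))).trans_lt hαβ))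
  have hrank : ∀ α : Ordinal.{u}, α < ω₁ → ∀ h : Acc NsdBelow (M α), α ≤ h.rank := by
    intro α
    induction α using WellFoundedLT.induction with
    | ind α ih =>
      intro hα h
      refine le_of_forall_lt fun β hβ => ?_
      have hlt := hMM β α hβ hα
      exact (ih β hβ (hβ.trans hα) (h.inv hlt)).trans_lt (h.rank_lt_of_rel hlt)
  rw [wadgeDegree]
  split_ifs with h hsd
  · refine WithTop.coe_le_coe.2 (le_of_forall_lt fun α hα => ?_)
    have hα1 := add_lt_omega_one hα hω1
    calc α < α + 1 := lt_add_one α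
      _ ≤ (h.inv (hML _ hα1)).rank := hrank _ hα1 _
      _ ≤ 1 + (h.inv (hML _ hα1)).rank := le_add_of_nonneg_left zero_le_one
      _ ≤ _ := Ordinal.le_iSup
        (fun N : {N : Set X // NsdBelow N L} => 1 + (h.inv N.2).rank) ⟨_, hML _ hα1⟩
  · refine WithTop.coe_le_coe.2 (le_of_forall_lt fun α hα => ?_)
    calc α ≤ (h.inv (hML α hα)).rank := hrank α hα _
      _ < h.rank := h.rank_lt_of_rel (hML α hα)
      _ ≤ 1 + h.rank := le_add_of_nonneg_left zero_le_one
  · exact le_top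

end Rank

/-! ### The prefix topology on trees -/

section Trees

variable {A : Type*}

theorem LTree.isSome_of_append (t : LTree A) (v w : List Bool)
    (h : (t.label (v ++ w)).isSome = true) : (t.label v).isSome = true := by
  induction w using List.reverseRecOn with
  | nil => simpa using h
  | append_singleton w d ih => exact ih (t.prefix_closed _ d (by simpa using h))

theorem LTree.label_append_eq_none (t : LTree A) {v : List Bool} (h : t.label v = none)
    (w : List Bool) : t.label (v ++ w) = none := by
  by_contra hne
  have := t.isSome_of_append v w (Option.isSome_iff_ne_none.2 hne)
  simp [h] at this

/-- The subtree of `t` rooted at `v`; it is empty if `v` is not a node of `t`. -/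
def LTree.subtree (t : LTree A) (v : List Bool) : LTree A where
  label w := t.label (v ++ w)
  prefix_closed w d h := t.prefix_closed (v ++ w) d (by simpa using h)

namespace MultiContext

/-- Along a path of `c` that ends in a node, no port is met before the end. -/
theorem plugLabel_append (c : MultiContext A) (η : List Bool → LTree A) (rest : List Bool) :
    ∀ mid done : List Bool, (c.label (done ++ mid)).isSome = true →
      c.plugLabel η done (mid ++ rest) = c.plugLabel η (done ++ mid) rest := by
  intro mid
  induction mid with
  | nil => intro done _; simp
  | cons d mid ih =>
    intro done h
    have h1 : (c.label (done ++ [d])).isSome = true :=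
      c.toLTree.isSome_of_append (done ++ [d]) mid (by simpa using h)
    have h2 := c.prefix_closed done d h1
    rw [List.cons_append, plugLabel]
    rcases hc : c.label done with _ | _ | a
    · simp [hc] at h2
    · simp [c.port_leaf done d hc] at h1
    · simpa using ih (done ++ [d]) (by simpa using h)

/-- The trees that extend `c` have the same label at the nodes of `c` other than ports, and no
further nodes outside the subtrees at the ports. -/
theorem mem_extensions_iff (c : MultiContext A) (t : LTree A) :
    t ∈ c.extensions ↔ (∀ v a, c.label v = some (some a) → t.label v = some a) ∧
      (c.label [] = none → t.label [] = none) ∧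
      ∀ v d a, c.label v = some (some a) → c.label (v ++ [d]) = none →
        t.label (v ++ [d]) = none := by
  constructor
  · rintro ⟨η, rfl⟩
    refine ⟨fun v a hv => ?_, fun h => ?_, fun v d a hv hd => ?_⟩
    · have := c.plugLabel_append η [] v [] (by simp [hv])
      simp only [List.append_nil, List.nil_append] at this
      change c.plugLabel η [] v = _
      rw [this, plugLabel, hv]
    · change c.plugLabel η [] [] = _
      rw [plugLabel, h]
    · have := c.plugLabel_append η [d] v [] (by simp [hv])
      change c.plugLabel η [] (v ++ [d]) = _
      rw [this, plugLabel]
      simp only [List.nil_append, hv]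
      rw [plugLabel, hd]
  · rintro ⟨h1, h2, h3⟩
    refine ⟨t.subtree, ?_⟩
    have key : ∀ rest done : List Bool, (c.label done = none → t.label done = none) →
        c.plugLabel t.subtree done rest = t.label (done ++ rest) := by
      intro rest
      induction rest with
      | nil =>
        intro done h
        rw [plugLabel]
        rcases hc : c.label done with _ | _ | a
        · simp [h hc]
        · rfl
        · simp [h1 done a hc]
      | cons d rest ih =>
        intro done h
        rw [plugLabel]
        rcases hc : c.label done with _ | _ | a
        · simp only [t.label_append_eq_none (h hc)]
        · rfl
        · simpa using ih (done ++ [d]) (h3 done d a hc)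
    ext1
    funext v
    exact key v [] h2

end MultiContext

/-- The prefix of `t` whose ports are the nodes of `t` at depth `n`. -/
def LTree.cut (t : LTree A) (n : ℕ) : TreePrefix A where
  label v := if v.length ≤ n then
    (t.label v).map fun a => if v.length < n then some a else none else none
  prefix_closed v d h := by
    by_cases hn : v.length + 1 ≤ n
    · have h1 : (t.label (v ++ [d])).isSome = true := by simpa [hn] using h
      have h2 := t.prefix_closed v d h1
      simpa [show v.length ≤ n by omega] using h2
    · simp [hn] at h
  port_leaf v d h := by
    by_cases hn : v.length < n
    · rw [if_pos hn.le] at h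
      simp [hn] at h
    · simp [show ¬ v.length + 1 ≤ n by omega]
  finite_dom := by
    refine (List.finite_length_le Bool n).subset fun v hv => ?_
    by_contra hn
    simp only [mem_ofPred_eq] at hv hn
    simp [hn] at hv

theorem LTree.mem_extensions_cut (t : LTree A) (n : ℕ) :
    t ∈ (t.cut n).toMultiContext.extensions := by
  rw [MultiContext.mem_extensions_iff]
  simp only [LTree.cut]
  refine ⟨fun v a h => ?_, fun h => by simpa using h, fun v d a h h' => ?_⟩
  · split_ifs at h with h1 h2
    · simpa using h
    · simp at h
  · split_ifs at h with h1 h2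
    · simpa [show v.length + 1 ≤ n by omega] using h'
    · simp at h

theorem LTree.label_eq_of_mem_extensions_cut {t t' : LTree A} {n : ℕ}
    (h : t' ∈ (t.cut n).toMultiContext.extensions) (v : List Bool) (hv : v.length < n) :
    t'.label v = t.label v := by
  obtain ⟨h1, h2, h3⟩ := (MultiContext.mem_extensions_iff _ _).1 h
  have hsome : ∀ w : List Bool, w.length < n → ∀ a, t.label w = some a →
      (t.cut n).label w = some (some a) := by
    intro w hw a ha
    simp [LTree.cut, hw, hw.le, ha]
  have hnone : ∀ w : List Bool, t.label w = none → (t.cut n).label w = none := by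
    intro w hw
    simp [LTree.cut, hw]
  induction v using List.reverseRecOn with
  | nil =>
    rcases ha : t.label [] with _ | a
    · exact h2 (hnone _ ha)
    · exact h1 _ a (hsome _ hv a ha)
  | append_singleton v d ih =>
    rcases ha : t.label (v ++ [d]) with _ | a
    · have hv' : v.length < n := by simp at hv; omega
      rcases hb : t.label v with _ | b
      · exact t'.label_append_eq_none ((ih hv').trans hb) [d]
      · exact h3 v d b (hsome v hv' b hb) (hnone _ ha)
    · exact h1 _ a (hsome _ hv a ha)

theorem isOpen_extensions (p : TreePrefix A) : IsOpen p.toMultiContext.extensions :=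
  isOpen_generateFrom_of_mem ⟨p, rfl⟩

/-- A bound on the depth of a prefix, with the property that trees which agree with one of its
extensions below this depth are extensions as well. -/
theorem TreePrefix.exists_depth (p : TreePrefix A) : ∃ n : ℕ, ∀ t ∈ p.toMultiContext.extensions,
    ∀ t' : LTree A, (∀ v, v.length < n → t'.label v = t.label v) →
      t' ∈ p.toMultiContext.extensions := by
  obtain ⟨m, hm⟩ := (p.finite_dom.image List.length).bddAbove
  have hlen : ∀ v, (p.label v).isSome = true → v.length ≤ m := fun v hv => hm ⟨v, hv, rfl⟩
  refine ⟨m + 2, fun t ht t' h => ?_⟩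
  rw [MultiContext.mem_extensions_iff] at ht ⊢
  obtain ⟨h1, h2, h3⟩ := ht
  refine ⟨fun v a hv => ?_, fun hv => ?_, fun v d a hv hd => ?_⟩
  · rw [h v (by have := hlen v (by simp [hv]); omega)]
    exact h1 v a hv
  · rw [h [] (by simp)]
    exact h2 hv
  · rw [h _ (by have := hlen v (by simp [hv]); simp; omega)]
    exact h3 v d a hv hd

theorem isClopen_label (v : List Bool) (o : Option A) : IsClopen {t : LTree A | t.label v = o} := by
  have hopen : ∀ P : Option A → Prop, IsOpen {t : LTree A | P (t.label v)} := by
    intro P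
    refine isOpen_iff_forall_mem_open.2 fun t ht =>
      ⟨_, fun t' ht' => ?_, isOpen_extensions (t.cut (v.length + 1)), t.mem_extensions_cut _⟩
    have := LTree.label_eq_of_mem_extensions_cut ht' v (Nat.lt_succ_self _)
    simpa only [mem_ofPred_eq, this] using ht
  exact ⟨⟨by simpa only [compl_ofPred] using hopen fun x => ¬ x = o⟩, hopen fun x => x = o⟩

/-- The prefix topology is the topology of pointwise convergence of the labels. -/
theorem topology_eq_generateFrom_label (A : Type*) : instTopologicalSpaceLTree A =
    generateFrom {U | ∃ (v : List Bool) (o : Option A), U = {t : LTree A | t.label v = o}} := by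
  refine le_antisymm (le_generateFrom ?_) (le_generateFrom ?_)
  · rintro _ ⟨v, o, rfl⟩
    exact (isClopen_label v o).isOpen
  · rintro _ ⟨p, rfl⟩
    obtain ⟨n, hn⟩ := p.exists_depth
    let _ : TopologicalSpace (LTree A) := generateFrom
      {U | ∃ (v : List Bool) (o : Option A), U = {t : LTree A | t.label v = o}}
    refine isOpen_iff_forall_mem_open.2 fun t ht =>
      ⟨⋂ v ∈ {v : List Bool | v.length < n}, {t' : LTree A | t'.label v = t.label v},
        fun t' ht' => hn t ht t' fun v hv => mem_iInter₂.1 ht' v hv,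
        (List.finite_length_lt Bool n).isOpen_biInter fun v _ =>
          isOpen_generateFrom_of_mem ⟨v, _, rfl⟩, by simp⟩

theorem exists_agree_subset {t : LTree A} {O : Set (LTree A)} (hO : O ∈ 𝓝 t) :
    ∃ n : ℕ, ∀ t' : LTree A, (∀ v, v.length < n → t'.label v = t.label v) → t' ∈ O := by
  have hb := isTopologicalBasis_of_subbasis (topology_eq_generateFrom_label A)
  obtain ⟨_, ⟨F, ⟨hF, hFs⟩, rfl⟩, htF, hFO⟩ := hb.mem_nhds_iff.1 hO
  have hU : ∀ U ∈ F, ∃ n : ℕ, ∀ t' : LTree A,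
      (∀ v : List Bool, v.length < n → t'.label v = t.label v) → t' ∈ U := by
    intro U hU
    obtain ⟨v, o, rfl⟩ := hFs hU
    have hto : t.label v = o := htF _ hU
    exact ⟨v.length + 1, fun t' h => (h v (Nat.lt_succ_self _)).trans hto⟩
  choose! n hn using hU
  obtain ⟨m, hm⟩ := (hF.image n).bddAbove
  refine ⟨m, fun t' h => hFO fun U hUF => hn U hUF t' fun v hv => h v ?_⟩
  exact hv.trans_le (hm ⟨U, hUF, rfl⟩)

/-- Every neighbourhood of `t` contains all extensions of some prefix of `t`. -/
theorem exists_prefix_subset {t : LTree A} {O : Set (LTree A)} (hO : O ∈ 𝓝 t) :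
    ∃ q : TreePrefix A, t ∈ q.toMultiContext.extensions ∧ q.toMultiContext.extensions ⊆ O := by
  obtain ⟨n, hn⟩ := exists_agree_subset hO
  exact ⟨t.cut n, t.mem_extensions_cut n, fun t' ht' => hn t' fun v hv =>
    LTree.label_eq_of_mem_extensions_cut ht' v hv⟩

theorem continuous_of_label {X : Type*} [TopologicalSpace X] {f : X → LTree A}
    (hf : ∀ v o, IsOpen {x | (f x).label v = o}) : Continuous f := by
  rw [topology_eq_generateFrom_label A]
  refine continuous_generateFrom_iff.2 ?_
  rintro _ ⟨v, o, rfl⟩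
  exact hf v o

/-- Over a finite alphabet there is a countable basis of clopen sets. -/
theorem exists_clopen_basis (A : Type*) [Finite A] : ∃ c : ℕ → Set (LTree A),
    (∀ n, IsClopen (c n)) ∧ IsTopologicalBasis (range c) := by
  let s : Set (Set (LTree A)) :=
    {U | ∃ (v : List Bool) (o : Option A), U = {t : LTree A | t.label v = o}}
  have hs : s.Countable := by
    have : s = range fun x : List Bool × Option A => {t : LTree A | t.label x.1 = x.2} := by
      ext U
      simp [s, eq_comm]
    rw [this]
    exact countable_range _
  have hb : IsTopologicalBasis ((fun f => ⋂₀ f) '' {f | f.Finite ∧ f ⊆ s}) :=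
    isTopologicalBasis_of_subbasis (topology_eq_generateFrom_label A)
  have hc := (countable_ofPred_finite_subset hs).image (fun f : Set (Set (LTree A)) => ⋂₀ f)
  obtain ⟨c, hcr⟩ := hc.exists_eq_range ⟨_, ∅, ⟨finite_empty, empty_subset _⟩, rfl⟩
  refine ⟨c, fun n => ?_, hcr ▸ hb⟩
  obtain ⟨F, ⟨hF, hFs⟩, hFn⟩ : c n ∈ (fun f => ⋂₀ f) '' {f | f.Finite ∧ f ⊆ s} :=
    hcr ▸ mem_range_self n
  rw [← hFn]
  simp only [sInter_eq_biInter]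
  refine hF.isClopen_biInter fun U hU => ?_
  obtain ⟨v, o, rfl⟩ := hFs hU
  exact isClopen_label v o

instance : Nonempty (LTree A) := ⟨⟨fun _ => none, by simp⟩⟩

end Trees

/-! ### Sets of trees with prescribed alternations -/

section Witnesses

variable {A : Type*}

/-- The tree with root label `a` and the given subtrees at the two children. -/
def LTree.node (a : A) (l r : LTree A) : LTree A where
  label
    | [] => some a
    | false :: v => l.label v
    | true :: v => r.label v
  prefix_closed v d h := by
    rcases v with _ | ⟨_ | _, v⟩
    · rfl
    · exact l.prefix_closed v d h
    · exact r.prefix_closed v d h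

/-- The tree whose nodes are the words `0 ^ k`, all labelled `a`. -/
def spine (a : A) : LTree A where
  label v := if true ∈ v then none else some a
  prefix_closed v d h := by
    by_contra h'
    have hv : true ∈ v := by
      by_contra hv
      exact h' (by simp [hv])
    simp [hv] at h

/-- The tree that consists of the nodes `0 ^ k` with `k ≤ n`, labelled `a`, and of `s` attached
as the right subtree of `0 ^ n`. -/
def graft (a : A) (s : LTree A) : ℕ → LTree A
  | 0 => .node a ⟨fun _ => none, by simp⟩ s
  | n + 1 => .node a (graft a s n) ⟨fun _ => none, by simp⟩

theorem continuous_graft (a : A) (n : ℕ) : Continuous fun s => graft a s n := by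
  refine continuous_of_label fun v o => ?_
  induction n generalizing v with
  | zero =>
    rcases v with _ | ⟨_ | _, v⟩
    · exact isOpen_const (p := some a = o)
    · exact isOpen_const (p := none = o)
    · exact (isClopen_label v o).isOpen
  | succ n ih =>
    rcases v with _ | ⟨_ | _, v⟩
    · exact isOpen_const (p := some a = o)
    · exact ih v
    · exact isOpen_const (p := none = o)

theorem continuous_subtree (w : List Bool) : Continuous fun t : LTree A => t.subtree w :=
  continuous_of_label fun v o => (isClopen_label (w ++ v) o).isOpen

theorem subtree_graft (a : A) (s : LTree A) (n : ℕ) :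
    (graft a s n).subtree (List.replicate n false ++ [true]) = s := by
  ext1
  funext v
  induction n with
  | zero => rfl
  | succ n ih => exact ih

theorem label_graft_replicate (a : A) (s : LTree A) (n : ℕ) :
    (graft a s n).label (List.replicate n false) = some a := by
  induction n with
  | zero => rfl
  | succ n ih => exact ih

theorem label_graft_replicate_succ (a : A) (s : LTree A) (n : ℕ) :
    (graft a s n).label (List.replicate (n + 1) false) = none := by
  induction n with
  | zero => rfl
  | succ n ih => exact ih

theorem label_graft_of_length_le (a : A) (s : LTree A) (n : ℕ) (v : List Bool)
    (hv : v.length ≤ n) : (graft a s n).label v = (spine a).label v := by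
  induction n generalizing v with
  | zero =>
    obtain rfl : v = [] := by simpa using hv
    rfl
  | succ n ih =>
    rcases v with _ | ⟨_ | _, v⟩
    · rfl
    · refine (ih v (by simpa using hv)).trans ?_
      simp [spine]
    · simp [spine, graft, LTree.node]

/-- The trees in which the leftmost branch ends in `0 ^ n`. -/
def leftDepth (A : Type*) (n : ℕ) : Set (LTree A) :=
  {t | (t.label (List.replicate n false)).isSome = true ∧
    t.label (List.replicate (n + 1) false) = none}

theorem isOpen_leftDepth (n : ℕ) : IsOpen (leftDepth A n) := by
  have : {t : LTree A | (t.label (List.replicate n false)).isSome = true} =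
      {t | t.label (List.replicate n false) = none}ᶜ := by
    ext t
    simp [Option.isSome_iff_ne_none]
  refine IsOpen.inter (s := {t | (t.label (List.replicate n false)).isSome = true}) ?_
    (isClopen_label _ none).isOpen
  rw [this]
  exact (isClopen_label _ none).compl.isOpen

theorem leftDepth_unique {t : LTree A} {m n : ℕ} (hm : t ∈ leftDepth A m)
    (hn : t ∈ leftDepth A n) : m = n := by
  have key : ∀ {i j : ℕ}, t ∈ leftDepth A i → t ∈ leftDepth A j → ¬ i < j := by
    intro i j hi hj hij
    have := t.isSome_of_append (List.replicate (i + 1) false)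
      (List.replicate (j - (i + 1)) false) (by
        rw [List.replicate_append_replicate, show i + 1 + (j - (i + 1)) = j by omega]
        exact hj.1)
    simp [hi.2] at this
  exact le_antisymm (not_lt.1 (key hn hm)) (not_lt.1 (key hm hn))

theorem graft_mem_leftDepth (a : A) (s : LTree A) (n : ℕ) : graft a s n ∈ leftDepth A n :=
  ⟨by simp [label_graft_replicate], label_graft_replicate_succ a s n⟩

theorem spine_notMem_leftDepth (a : A) (n : ℕ) : spine a ∉ leftDepth A n := fun h => by
  have := h.2
  simp [spine] at this

/-- Every countable ordinal is the number of alternations of some set. Outside the sets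
`leftDepth A n` everything is put into `M`, and inside `leftDepth A n` the set `M` is a copy of
the complement of a set of smaller rank `β n`, where every smaller rank occurs for infinitely many
`n`. These copies accumulate at the spine, so that `α` alternations starting in `Mᶜ` are possible
arbitrarily close to it, while after a first step into `Mᶜ` one is confined to one copy. -/
theorem exists_alternation (a : A) (α : Ordinal.{v}) : α < ω₁ → ∃ M : Set (LTree A),
    (altDeriv (α + 1) M).Nonempty ∧ altDeriv (α + 1) Mᶜ = ∅ := by
  induction α using WellFoundedLT.induction with
  | ind α ih =>
    intro hα
    rcases eq_or_ne α 0 with rfl | hα0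
    · refine ⟨univ, ⟨spine a, mem_altDeriv_of_mem trivial (mem_altDeriv.2 fun β hβ => ?_)⟩, ?_⟩
      · exact absurd hβ (not_lt_zero)
      · refine eq_empty_of_forall_notMem fun x hx => ?_
        simpa using mem_altDeriv_add_one.1 hx
    have hcount := countable_Iio_of_lt_omega_one hα
    have : Nonempty (Iio α) := ⟨⟨0, pos_iff_ne_zero.2 hα0⟩⟩
    obtain ⟨e, he⟩ := exists_surjective_nat (Iio α)
    let β : ℕ → Ordinal.{v} := fun n => (e n.unpair.1).1
    have hβ : ∀ n, β n < α := fun n => (e n.unpair.1).2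
    have hsm : ∀ n, ∃ M : Set (LTree A),
        (altDeriv (β n + 1) M).Nonempty ∧ altDeriv (β n + 1) Mᶜ = ∅ :=
      fun n => ih _ (hβ n) ((hβ n).trans hα)
    choose N hN hN' using hsm
    let g : ℕ → LTree A → LTree A := fun n t => t.subtree (List.replicate n false ++ [true])
    let M : Set (LTree A) := {t | ∀ n, t ∈ leftDepth A n → g n t ∉ N n}
    have hMg : ∀ n, ∀ t ∈ leftDepth A n, t ∈ M ↔ g n t ∈ (N n)ᶜ := by
      refine fun n t ht => ⟨fun h => h n ht, fun h m hm => ?_⟩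
      obtain rfl := leftDepth_unique hm ht
      exact h
    have hMe : ∀ n s, graft a s n ∈ Mᶜ ↔ s ∈ N n := by
      intro n s
      rw [mem_compl_iff, hMg n _ (graft_mem_leftDepth a s n), mem_compl_iff, not_not]
      simp only [g, subtree_graft]
    have hspine : spine a ∈ M := fun n h => absurd h (spine_notMem_leftDepth a n)
    refine ⟨M, ⟨spine a, mem_altDeriv_of_mem hspine (mem_altDeriv.2 fun δ hδ => ?_)⟩, ?_⟩
    · rw [compl_compl, mem_closure_iff_nhds]
      intro O hO
      obtain ⟨m, hm⟩ := exists_agree_subset hO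
      obtain ⟨i, hi⟩ := he ⟨δ, hδ⟩
      -- A copy of rank `δ` which agrees with the spine up to depth `m`.
      set n : ℕ := Nat.pair i m with hn
      have hβn : β n = δ := by simp [β, hn, hi]
      obtain ⟨x, hx⟩ := hN n
      obtain ⟨s, -, hsN, hs⟩ :=
        mem_closure_iff.1 (mem_altDeriv_add_one.1 hx) univ isOpen_univ trivial
      refine ⟨graft a s n, hm _ fun v hv => ?_, (hMe n s).2 hsN, ?_⟩
      · exact label_graft_of_length_le a s n v (hv.le.trans (Nat.right_le_pair i m))
      · rw [hβn] at hs
        refine map_mem_altDeriv (continuous_graft a n) isOpen_univ δ (fun t _ => ?_) s trivial hs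
        rw [mem_compl_iff, ← hMe n t, mem_compl_iff, not_not]
    · refine eq_empty_of_forall_notMem fun x hx => ?_
      obtain ⟨t, -, htM, ht⟩ :=
        mem_closure_iff.1 (mem_altDeriv_add_one.1 hx) univ isOpen_univ trivial
      rw [compl_compl] at ht
      obtain ⟨n, htn, -⟩ : ∃ n, t ∈ leftDepth A n ∧ g n t ∈ N n := by
        simpa [M] using htM
      have := map_mem_altDeriv (f := g n) (continuous_subtree _) (isOpen_leftDepth n) α (hMg n) t
        htn ht
      rw [altDeriv_eq_empty_of_le (hN' n) (Order.add_one_le_of_lt (hβ n))] at this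
      exact this

end Witnesses

/-! ### The infinite cutting game -/

section Game

variable {A : Type*}

theorem AlternatorStrategy.length_history (σ : AlternatorStrategy A) (c : ℕ → TreePrefix A)
    (n : ℕ) : (σ.history c n).length = n := by
  induction n with
  | zero => rfl
  | succ n ih => simp [AlternatorStrategy.history, ih]

theorem AlternatorStrategy.history_congr (σ : AlternatorStrategy A) {c c' : ℕ → TreePrefix A}
    {n : ℕ} (h : ∀ i < n, c i = c' i) : σ.history c n = σ.history c' n := by
  induction n with
  | zero => rfl
  | succ n ih =>
    rw [AlternatorStrategy.history, AlternatorStrategy.history,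
      ih fun i hi => h i (hi.trans (Nat.lt_succ_self n)), h n (Nat.lt_succ_self n)]

theorem alternating_eq (L : Set (LTree A)) (n : ℕ) :
    alternating L Lᶜ n = L ∧ alternating L Lᶜ (n + 1) = Lᶜ ∨
      alternating L Lᶜ n = Lᶜ ∧ alternating L Lᶜ (n + 1) = L := by
  by_cases h : Even n <;> simp [alternating, h, Nat.even_add_one]

/-- The moves of a winning strategy, in plays where Constrainer never allows Alternator to leave
the extensions of `p`, form a set in which both `L` and its complement are dense: if Constrainer
answers such a move with a small prefix, Alternator's next move is close to it and on the other
side. -/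
theorem exists_dense_of_alternatorWins {p : TreePrefix A} {L : Set (LTree A)}
    (h : AlternatorWinsInfinite p (alternating L Lᶜ)) :
    ∃ S : Set (LTree A), S.Nonempty ∧ S ⊆ p.toMultiContext.extensions ∧
      S ⊆ closure (S ∩ L) ∧ S ⊆ closure (S ∩ Lᶜ) := by
  obtain ⟨σ, hσ⟩ := h
  let Legal : (ℕ → TreePrefix A) → ℕ → Prop := fun c n => ∀ i < n,
    σ.move c i ∈ (c i).toMultiContext.extensions ∧
      (c i).toMultiContext.extensions ⊆ p.toMultiContext.extensions
  let S : Set (LTree A) := {t | ∃ c n, Legal c n ∧ σ.move c n = t}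
  have hwin : ∀ c n, Legal c n → σ.move c n ∈ alternating L Lᶜ n ∧
      σ.move c n ∈ p.toMultiContext.extensions := by
    intro c n hc
    obtain ⟨h1, h2⟩ := hσ c n fun i hi => (hc i hi).1
    refine ⟨h1, ?_⟩
    rcases n with _ | n
    · exact h2
    · exact (hc n (Nat.lt_succ_self n)).2 h2
  have hstep : ∀ c n, Legal c n → σ.move c n ∈ closure (S ∩ alternating L Lᶜ (n + 1)) := by
    intro c n hc
    refine mem_closure_iff_nhds.2 fun O hO => ?_
    obtain ⟨q, hq, hqO⟩ := exists_prefix_subset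
      (inter_mem hO ((isOpen_extensions p).mem_nhds (hwin c n hc).2))
    have hne : ∀ i < n, Function.update c n q i = c i := fun i hi =>
      Function.update_of_ne hi.ne q c
    have hmove : ∀ i ≤ n, σ.move (Function.update c n q) i = σ.move c i := fun i hi =>
      congrArg σ (σ.history_congr fun j hj => hne j (hj.trans_le hi))
    have hleg : Legal (Function.update c n q) (n + 1) := by
      intro i hi
      rw [hmove i (Nat.lt_succ_iff.1 hi)]
      rcases (Nat.lt_succ_iff.1 hi).lt_or_eq with hlt | rfl
      · rw [hne i hlt]
        exact hc i hlt
      · rw [Function.update_self]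
        exact ⟨hq, fun t ht => (hqO ht).2⟩
    refine ⟨σ.move (Function.update c n q) (n + 1), (hqO ?_).1, ⟨_, _, hleg, rfl⟩,
      (hwin _ _ hleg).1⟩
    have := (hσ _ _ fun i hi => (hleg i hi).1).2
    rwa [constraint, Function.update_self] at this
  refine ⟨S, ?_, ?_, ?_, ?_⟩
  · have c : ℕ → TreePrefix A := fun _ => p
    exact ⟨_, c, 0, fun i hi => absurd hi (Nat.not_lt_zero i), rfl⟩
  · rintro _ ⟨c, n, hc, rfl⟩
    exact (hwin c n hc).2
  · rintro _ ⟨c, n, hc, rfl⟩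
    rcases alternating_eq L n with ⟨h1, h2⟩ | ⟨h1, h2⟩
    · exact subset_closure ⟨⟨c, n, hc, rfl⟩, h1 ▸ (hwin c n hc).1⟩
    · exact h2 ▸ hstep c n hc
  · rintro _ ⟨c, n, hc, rfl⟩
    rcases alternating_eq L n with ⟨h1, h2⟩ | ⟨h1, h2⟩
    · exact h2 ▸ hstep c n hc
    · exact subset_closure ⟨⟨c, n, hc, rfl⟩, h1 ▸ (hwin c n hc).1⟩

/-- Alternator wins by always moving inside a set in which `L` and its complement are dense. -/
theorem alternatorWins_of_dense {p : TreePrefix A} {L S : Set (LTree A)} (hS : S.Nonempty)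
    (hp : S ⊆ p.toMultiContext.extensions) (h : S ⊆ closure (S ∩ L))
    (h' : S ⊆ closure (S ∩ Lᶜ)) : AlternatorWinsInfinite p (alternating L Lᶜ) := by
  classical
  let last : List (LTree A × TreePrefix A) → TreePrefix A := fun l =>
    match l.getLast? with
    | none => p
    | some x => x.2
  let good : List (LTree A × TreePrefix A) → Set (LTree A) := fun l =>
    (last l).toMultiContext.extensions ∩ (S ∩ alternating L Lᶜ l.length)
  let σ : AlternatorStrategy A := fun l => if hl : (good l).Nonempty then hl.some else hS.some
  have hσ : ∀ l, (good l).Nonempty → σ l ∈ good l := fun l hl => by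
    simp only [σ, dif_pos hl]
    exact hl.some_mem
  have hlast : ∀ c n, last (σ.history c n) = constraint p c n := by
    intro c n
    cases n with
    | zero => rfl
    | succ n => simp [last, AlternatorStrategy.history, constraint]
  have hdense : ∀ n, S ⊆ closure (S ∩ alternating L Lᶜ n) := by
    intro n
    rcases alternating_eq L n with ⟨h1, -⟩ | ⟨h1, -⟩ <;> rw [h1] <;> assumption
  have key : ∀ c n, (∀ i < n, σ.move c i ∈ (c i).toMultiContext.extensions) →
      σ.move c n ∈ good (σ.history c n) := by
    intro c n
    induction n with
    | zero =>
      intro _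
      refine hσ (σ.history c 0) ?_
      obtain ⟨x, hx⟩ := hS
      obtain ⟨t, ht⟩ := closure_nonempty_iff.1 ⟨x, hdense 0 hx⟩
      exact ⟨t, hp ht.1, ht⟩
    | succ n ih =>
      intro hc
      refine hσ (σ.history c (n + 1)) ?_
      have h1 := ih fun i hi => hc i (hi.trans (Nat.lt_succ_self n))
      have h2 := mem_closure_iff.1 (hdense (n + 1) h1.2.1) _ (isOpen_extensions (c n))
        (hc n (Nat.lt_succ_self n))
      simpa only [good, hlast, σ.length_history, constraint] using h2
  refine ⟨σ, fun c n hc => ?_⟩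
  have h1 := key c n hc
  simp only [good, hlast, σ.length_history] at h1
  exact ⟨h1.2.2, h1.1⟩

end Game

end TreeLang

theorem proposition3 {A : Type*} [Finite A] (L : Set (TreeLang.LTree A))
    (p : TreeLang.TreePrefix A) :
    ((Ordinal.omega 1 : Ordinal) : WithTop Ordinal) ≤
        TreeLang.wadgeDegree (p.toMultiContext.restrict L) ↔
      TreeLang.AlternatorWinsInfinite p (TreeLang.alternating L Lᶜ) := by
  obtain ⟨c, hc, hb⟩ := TreeLang.exists_clopen_basis A
  set K : Set (TreeLang.LTree A) := p.toMultiContext.restrict L with hK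
  constructor
  · intro h
    rcases TreeLang.altDeriv_eq_empty_or_exists_dense hb K with
      ⟨γ, hγω, hγ, hγ'⟩ | ⟨S, ⟨x, hx⟩, hSK, hSK'⟩
    · exact absurd (TreeLang.wadgeDegree_lt_omega_one hc hb hγω hγ hγ') (not_lt.2 h)
    -- Intersecting with the open set of the extensions of `p` keeps both parts dense.
    · have hop := TreeLang.isOpen_extensions p
      obtain ⟨t, htS, ht⟩ := closure_nonempty_iff.1 ⟨x, hSK hx⟩
      refine TreeLang.alternatorWins_of_dense (S := p.toMultiContext.extensions ∩ S)
        ⟨t, ht.2, htS⟩ inter_subset_left ?_ ?_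
      · rintro y ⟨hyp, hyS⟩
        refine closure_mono ?_ (hop.inter_closure ⟨hyp, hSK hyS⟩)
        exact fun z hz => ⟨⟨hz.1, hz.2.1⟩, hz.2.2.1⟩
      · rintro y ⟨hyp, hyS⟩
        refine closure_mono ?_ (hop.inter_closure ⟨hyp, hSK' hyS⟩)
        exact fun z hz => ⟨⟨hz.1, hz.2.1⟩, fun hzL => hz.2.2 ⟨hzL, hz.1⟩⟩
  · intro h
    obtain ⟨S, ⟨x, hx⟩, hp, hSL, hSL'⟩ := TreeLang.exists_dense_of_alternatorWins h
    have hSK : S ⊆ closure (S ∩ K) := hSL.trans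
      (closure_mono fun z hz => ⟨hz.1, hz.2, hp hz.1⟩)
    have hSK' : S ⊆ closure (S ∩ Kᶜ) := hSL'.trans
      (closure_mono fun z hz => ⟨hz.1, fun hzK => hz.2 hzK.1⟩)
    -- Without letters there is only the empty tree, in which no alternation is possible.
    obtain ⟨a⟩ : Nonempty A := by
      by_contra hA
      rw [not_nonempty_iff] at hA
      have hsub : ∀ s t : TreeLang.LTree A, s = t := fun s t => by
        ext1
        funext v
        exact Subsingleton.elim _ _
      obtain ⟨s, -, hs⟩ := closure_nonempty_iff.1 ⟨x, hSL hx⟩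
      obtain ⟨t, -, ht⟩ := closure_nonempty_iff.1 ⟨x, hSL' hx⟩
      exact ht (hsub s t ▸ hs)
    exact TreeLang.omega_one_le_wadgeDegree hc hb (TreeLang.exists_alternation a)
      (fun α => ⟨x, TreeLang.subset_altDeriv hSK hSK' α hx⟩)
      (fun α => ⟨x, TreeLang.subset_altDeriv hSK' (by rwa [compl_compl]) α hx⟩)
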